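/- Let $p$ be a prime number and let $K$ be a finite extension of $\mathbf{Q}_p$, with ring of integers $\mathfrak{o}$ and maximal ideal $\mathfrak{p}$ of $\mathfrak o$. Put $d=[K:\mathbf{Q}_p]$. Let $e$ be the absolute ramification index of $K$ if $p=2$, and $e=0$ if $p\neq 2$. For $n\ge 0$ let $U_n=\operatorname{Ker}(\mathfrak{o}^\times\to(\mathfrak{o}/\mathfrak{p}^n)^\times)$ (so $U_0=\mathfrak{o}^\times$), and let $\bar U_n$ be the image of $U_n$ in $K^\times/\mathfrak{o}^{\times 2}$; in particular $\bar U_0=\mathfrak{o}^\times/\mathfrak{o}^{\times 2}$. For a finite extension $L|K$ with ring of integers $\mathfrak{o}_L$, the discriminant $d_{L|K}\in K^\times/\mathfrak{o}^{\times 2}$ is the class of $\det(\operatorname{Tr}_{L|K}(b_ib_j))_{i,j}$ for any $\mathfrak{o}$-basis $(b_i)_i$ of $\mathfrak{o}_L$; it does not depend on the basis. Then $\bar U_{2e}=\{1,u\}$ for some $u\neq 1$, so that $\bar U_{2e}$ is an $\mathbf{F}_2$-line. For every finite unramified extension $L$ of $K$, of degree $r=[L:K]$, the discriminant $d_{L|K}$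 belongs to $\bar U_{2e}$; one has $d_{L|K}=1$ if $r$ is odd and $d_{L|K}=u$ if $r$ is even. If $p=2$, then $\mathfrak{o}^\times/\mathfrak{o}^{\times 2}$ has exactly $2^{d+1}-2$ elements other than $1$ and $u$, and none of them is the discriminant $d_{L|K}$ of a finite extension $L|K$, ramified or not. -/

import Mathlib

universe u v

namespace LocalDisc

theorem charZero (p : ℕ) [Fact p.Prime] (K : Type*) [Field K] [Algebra ℚ_[p] K] : CharZero K :=
  charZero_of_injective_algebraMap (algebraMap ℚ_[p] K).injective

section BaseField

variable (p : ℕ) [Fact p.Prime] (K : Type*) [Field K] [Algebra ℚ_[p] K]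
  [FiniteDimensional ℚ_[p] K]

/-- The ring of integers `𝔬` of a finite extension `K` of `ℚ_p`: the elements of absolute value
at most `1`, for the unique extension to `K` of the `p`-adic absolute value. -/
noncomputable def integers : ValuationSubring K where
  carrier := {x | spectralNorm ℚ_[p] K x ≤ 1}
  mul_mem' {x y} hx hy := by
    have h := map_mul (spectralMulAlgNorm ℚ_[p] K) x y
    simp only [spectralMulAlgNorm_def] at h
    change spectralNorm ℚ_[p] K x ≤ 1 at hx
    change spectralNorm ℚ_[p] K y ≤ 1 at hy
    change spectralNorm ℚ_[p] K (x * y) ≤ 1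
    rw [h]
    exact mul_le_one₀ hx (spectralNorm_nonneg y) hy
  one_mem' := spectralNorm_one.le
  add_mem' {x y} hx hy := (isNonarchimedean_spectralNorm x y).trans (max_le hx hy)
  zero_mem' := by simp [spectralNorm_zero]
  neg_mem' {x} hx := by
    simpa [spectralNorm_neg (Algebra.IsAlgebraic.isAlgebraic x)] using hx
  mem_or_inv_mem' x := by
    have h := map_inv₀ (spectralMulAlgNorm ℚ_[p] K) x
    simp only [spectralMulAlgNorm_def] at h
    change spectralNorm ℚ_[p] K x ≤ 1 ∨ spectralNorm ℚ_[p] K x⁻¹ ≤ 1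
    rw [h]
    exact (le_total (spectralNorm ℚ_[p] K x) 1).imp id inv_le_one_of_one_le₀

theorem mem_integers_iff (x : K) : x ∈ integers p K ↔ spectralNorm ℚ_[p] K x ≤ 1 := Iff.rfl

theorem natCast_prime_not_isUnit : ¬ IsUnit ((p : ℕ) : integers p K) := by
  intro h
  obtain ⟨y, hy⟩ := h.exists_right_inv
  have hy' : (p : K) * (y : K) = 1 := by simpa using congrArg (Subtype.val) hy
  have h1 := map_mul (spectralMulAlgNorm ℚ_[p] K) (p : K) y
  simp only [spectralMulAlgNorm_def] at h1
  have h2 : spectralNorm ℚ_[p] K (p : K) = (p : ℝ)⁻¹ := by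
    have := spectralNorm_extends (K := ℚ_[p]) (L := K) (p : ℚ_[p])
    simpa using this
  rw [hy', spectralNorm_one, h2] at h1
  have h3 : (p : ℝ)⁻¹ < 1 := inv_lt_one_of_one_lt₀ (by exact_mod_cast (Fact.out : p.Prime).one_lt)
  have h4 : (p : ℝ)⁻¹ * spectralNorm ℚ_[p] K y < 1 :=
    (mul_le_of_le_one_right (by positivity) y.2).trans_lt h3
  exact h4.ne h1.symm

theorem isIntegralElem_of_mem_integers {x : K} (hx : x ∈ integers p K) :
    ((algebraMap ℚ_[p] K).comp (algebraMap ℤ_[p] ℚ_[p])).IsIntegralElem x := by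
  have hm : (minpoly ℚ_[p] x).Monic := minpoly.monic (Algebra.IsIntegral.isIntegral x)
  have hc : ∀ n, ‖(minpoly ℚ_[p] x).coeff n‖ ≤ 1 := (spectralValue_le_one_iff hm).mp hx
  have hl : minpoly ℚ_[p] x ∈ Polynomial.lifts (algebraMap ℤ_[p] ℚ_[p]) :=
    (Polynomial.lifts_iff_coeff_lifts _).mpr fun n => ⟨⟨_, hc n⟩, rfl⟩
  obtain ⟨q, hq, -, hqm⟩ := Polynomial.lifts_and_natDegree_eq_and_monic hl hm
  refine ⟨q, hqm, ?_⟩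
  rw [← Polynomial.eval₂_map, hq]
  exact minpoly.aeval _ x

instance : IsNoetherianRing (integers p K) := by
  let : Algebra ℤ_[p] K := ((algebraMap ℚ_[p] K).comp (algebraMap ℤ_[p] ℚ_[p])).toAlgebra
  have : IsScalarTower ℤ_[p] ℚ_[p] K := IsScalarTower.of_algebraMap_eq' rfl
  have : CharZero K := charZero p K
  have hmem (a : ℤ_[p]) : algebraMap ℤ_[p] K a ∈ integers p K := by
    change spectralNorm ℚ_[p] K (algebraMap ℚ_[p] K (a : ℚ_[p])) ≤ 1
    rw [spectralNorm_extends]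
    exact a.2
  let : Algebra ℤ_[p] (integers p K) :=
    ((algebraMap ℤ_[p] K).codRestrict (integers p K).toSubring hmem).toAlgebra
  let f : integers p K →ₗ[ℤ_[p]] integralClosure ℤ_[p] K :=
    { toFun := fun x => ⟨x, isIntegralElem_of_mem_integers p K x.2⟩
      map_add' := fun _ _ => rfl
      map_smul' := fun a x => by
        apply Subtype.ext
        simp only [Algebra.smul_def]
        rfl }
  have hN : IsNoetherian ℤ_[p] (integralClosure ℤ_[p] K) :=
    IsIntegralClosure.isNoetherian ℤ_[p] ℚ_[p] K _
  have hf : Function.Injective f := fun x y h =>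
    Subtype.ext (congrArg (fun z : integralClosure ℤ_[p] K => (z : K)) h)
  exact isNoetherianRing_iff.mpr
    (isNoetherian_of_tower ℤ_[p] (isNoetherian_of_injective f hf))

instance : IsDiscreteValuationRing (integers p K) := by
  have hF : ¬ IsField (integers p K) := fun h => by
    have : CharZero K := charZero p K
    have hp : ((p : ℕ) : integers p K) ≠ 0 := fun h0 => by
      have : (p : K) = 0 := by simpa using congrArg Subtype.val h0
      exact (Fact.out : p.Prime).ne_zero (by exact_mod_cast this)
    obtain ⟨b, hb⟩ := h.mul_inv_cancel hp
    exact natCast_prime_not_isUnit p K (IsUnit.of_mul_eq_one b hb)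
  have h := ((IsDiscreteValuationRing.TFAE (integers p K) hF).out 0 1 :
    IsDiscreteValuationRing (integers p K) ↔ ValuationRing (integers p K))
  exact h.mpr inferInstance

/-- The subgroup `U_n = Ker(𝔬ˣ → (𝔬/𝔭ⁿ)ˣ)` of `𝔬ˣ`, where `𝔭` is the maximal ideal of `𝔬`.
For `n = 0` it is all of `𝔬ˣ`. -/
noncomputable def unitFiltration (n : ℕ) : Subgroup (integers p K)ˣ :=
  (Units.map (Ideal.Quotient.mk
    (IsLocalRing.maximalIdeal (integers p K) ^ n)).toMonoidHom).ker

/-- The inclusion `𝔬ˣ → Kˣ`. -/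
noncomputable def unitsIncl : (integers p K)ˣ →* Kˣ :=
  Units.map (algebraMap (integers p K) K).toMonoidHom

/-- The group `𝔬ˣ²` of squares of units of `𝔬`, as a subgroup of `Kˣ`. -/
noncomputable def unitSquares : Subgroup Kˣ :=
  (powMonoidHom 2 : (integers p K)ˣ →* (integers p K)ˣ).range.map (unitsIncl p K)

/-- The group `Kˣ/𝔬ˣ²`. -/
abbrev UnitClasses := Kˣ ⧸ unitSquares p K

/-- The image `Ū_n` of `U_n` in `Kˣ/𝔬ˣ²`. In particular `Ū_0` is the subgroup `𝔬ˣ/𝔬ˣ²`. -/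
noncomputable def barU (n : ℕ) : Subgroup (UnitClasses p K) :=
  ((unitFiltration p K n).map (unitsIncl p K)).map (QuotientGroup.mk' (unitSquares p K))

open Classical in
/-- The integer `e`: the absolute ramification index of `K` (the normalised valuation of `p`)
if `p = 2`, and `0` if `p ≠ 2`. -/
noncomputable def ramIdx : ℕ :=
  if p = 2 then (IsDiscreteValuationRing.addVal (integers p K) (p : integers p K)).toNat else 0

section Extension

variable (L : Type*) [Field L] [Algebra K L]

/-- The ring of integers `𝔬_L` of a finite extension `L` of `K`: the integral closure of `𝔬`
in `L`. -/
noncomputable abbrev extIntegers : Subalgebra (integers p K) L := integralClosure (integers p K) L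

/-- The extension `L | K` is unramified when `𝔬_L` is an unramified `𝔬`-algebra: as the residue
fields are finite, this says that `𝔭 𝔬_L` is the maximal ideal of `𝔬_L`, that is, `L | K` has
ramification index `1`. -/
def IsUnramified : Prop := Algebra.FormallyUnramified (integers p K) (extIntegers p K L)

variable [FiniteDimensional K L]

instance : Module.Free (integers p K) (extIntegers p K L) := by
  have : CharZero K := charZero p K
  have : Module.IsTorsionFree (integers p K) L := .trans_faithfulSMul _ K _
  exact IsIntegralClosure.module_free (integers p K) K L _

instance : Module.Finite (integers p K) (extIntegers p K L) := by
  have : CharZero K := charZero p K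
  exact IsIntegralClosure.finite (integers p K) K L _

theorem discr_basis_eq {ι : Type*} [Fintype ι] [DecidableEq ι]
    (b : Module.Basis ι (integers p K) (extIntegers p K L)) :
    Algebra.discr K (fun i => (b i : L)) =
      algebraMap (integers p K) K (Algebra.discr (integers p K) b) := by
  have : CharZero K := charZero p K
  have : IsLocalization (Algebra.algebraMapSubmonoid (extIntegers p K L)
      (nonZeroDivisors (integers p K))) L :=
    IsIntegralClosure.isLocalization (integers p K) K L _
  rw [← Algebra.discr_localizationLocalization (integers p K)
    (nonZeroDivisors (integers p K)) L b]
  congr 1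
  ext i
  simp [Module.Basis.localizationLocalization_apply]

theorem discr_basis_ne_zero {ι : Type*} [Fintype ι] [DecidableEq ι]
    (b : Module.Basis ι (integers p K) (extIntegers p K L)) :
    Algebra.discr K (fun i => (b i : L)) ≠ 0 := by
  have : CharZero K := charZero p K
  have : IsLocalization (Algebra.algebraMapSubmonoid (extIntegers p K L)
      (nonZeroDivisors (integers p K))) L :=
    IsIntegralClosure.isLocalization (integers p K) K L _
  have h := Algebra.discr_not_zero_of_basis K
    (b.localizationLocalization K (nonZeroDivisors (integers p K)) L)
  convert h using 2
  ext i
  simp [Module.Basis.localizationLocalization_apply]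

/-- The class in `Kˣ/𝔬ˣ²` of the discriminant `det (Tr_{L|K} (bᵢ bⱼ))` of a basis `b` of `𝔬_L`
over `𝔬`. -/
noncomputable def discrOfBasis {ι : Type*} [Fintype ι] [DecidableEq ι]
    (b : Module.Basis ι (integers p K) (extIntegers p K L)) : UnitClasses p K :=
  QuotientGroup.mk (Units.mk0 (Algebra.discr K (fun i => (b i : L)))
    (discr_basis_ne_zero p K L b))

open Classical in
/-- The discriminant `d_{L|K}` of a finite extension `L | K`, an element of `Kˣ/𝔬ˣ²`: the class
of the discriminant of any basis of `𝔬_L` over `𝔬`. -/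
noncomputable def discr : UnitClasses p K :=
  discrOfBasis p K L (Module.Free.chooseBasis (integers p K) (extIntegers p K L))

/-- The discriminant does not depend on the basis. -/
theorem discrOfBasis_eq_discr {ι : Type*} [Fintype ι] [DecidableEq ι]
    (b : Module.Basis ι (integers p K) (extIntegers p K L)) :
    discrOfBasis p K L b = discr p K L := by
  classical
  let c := Module.Free.chooseBasis (integers p K) (extIntegers p K L)
  let c' := c.reindex (c.indexEquiv b)
  have hc' : Algebra.discr (integers p K) c' = Algebra.discr (integers p K) c := by
    simp only [c', Module.Basis.coe_reindex, Algebra.discr_reindex]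
  have hu : IsUnit (b.toMatrix c').det := by
    rw [← LinearMap.toMatrix_id_eq_basis_toMatrix c' b]
    exact LinearEquiv.isUnit_det (LinearEquiv.refl _ _) c' b
  obtain ⟨w, hw⟩ := hu
  have hd : Algebra.discr (integers p K) c' =
      (b.toMatrix c').det ^ 2 * Algebra.discr (integers p K) b := by
    rw [← Algebra.discr_of_matrix_vecMul, Module.Basis.toMatrix_map_vecMul]
  refine QuotientGroup.eq.mpr ⟨w ^ 2, ⟨w, rfl⟩, ?_⟩
  rw [eq_inv_mul_iff_mul_eq]
  ext
  change Algebra.discr K (fun i => (b i : L)) *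
      algebraMap (integers p K) K ((w : integers p K) ^ 2) =
    Algebra.discr K (fun i => (c i : L))
  rw [discr_basis_eq p K L b, discr_basis_eq p K L c, ← hc', hd, hw, map_mul, mul_comm]

end Extension

end BaseField

end LocalDisc

/-! Two facts about `1 + 4𝔬` drive the proof. First, `U_{2e}` is the group of units `1 + 4c`, for
every `p`, and `(1 + 2z)² = 1 + 4(z² + z)`. By Hensel, `1 + 4c` is a square exactly when `z² + z =
c` is solvable in the residue field. Over a finite field the obstruction takes two values
(Artin–Schreier in characteristic two, quadratic character otherwise), so `Ū_{2e}` has order two.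
Second, a discriminant is a square modulo `4` (Stickelberger), so one that is a unit has its class
in `Ū_{2e}`. This excludes every other unit class, whether or not `L | K` is ramified. If `L | K` is
unramified of degree `r`, reduction modulo `𝔭` shows that the discriminant is a unit, and a lift of
Frobenius generates a cyclic Galois group. The generator permutes the columns of the matrix of
conjugates by an `r`-cycle, so the square root of the discriminant lies in `K` exactly when `r` is
odd. For `p = 2`, the order `2^(d+1)` of `𝔬ˣ/𝔬ˣ²` comes from comparing squaring on `V = 1 + 4𝔬`,
where `[V : V²] = 2^d`, with squaring on `𝔬ˣ`, whose kernel is `±1`. -/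

namespace LocalDisc

open IsLocalRing

/-! ### Completeness of `𝔬` and size of `𝔬/p`. -/

section Base

variable (p : ℕ) [Fact p.Prime] (K : Type*) [Field K] [Algebra ℚ_[p] K]
  [FiniteDimensional ℚ_[p] K]

instance charZero_integers : CharZero (integers p K) where
  cast_injective a b hab := by
    have := charZero p K
    exact Nat.cast_injective (R := K) (by simpa using congrArg Subtype.val hab)

/-- Translates `𝔭`-adic congruences into norm bounds, so that metric completeness of `K` yields adic
completeness of `𝔬`. -/
theorem mem_maximalIdeal_pow_iff {π : integers p K} (hπ : Irreducible π) (n : ℕ)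
    (x : integers p K) :
    x ∈ maximalIdeal (integers p K) ^ n ↔
      spectralNorm ℚ_[p] K x ≤ spectralNorm ℚ_[p] K π ^ n := by
  let := spectralNorm.normedField ℚ_[p] K
  have hnorm (y : K) : spectralNorm ℚ_[p] K y = ‖y‖ := rfl
  have hπ0 : (π : K) ≠ 0 := fun h => hπ.ne_zero (Subtype.ext h)
  rw [hπ.maximalIdeal_eq, Ideal.span_singleton_pow, Ideal.mem_span_singleton, hnorm, hnorm,
    ← norm_pow]
  constructor
  · rintro ⟨y, rfl⟩
    have hy : ‖(y : K)‖ ≤ 1 := y.2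
    push_cast
    rw [norm_mul]
    exact mul_le_of_le_one_right (norm_nonneg _) hy
  · intro h
    refine ⟨⟨x / (π : K) ^ n, ?_⟩, Subtype.ext ?_⟩
    · change ‖(x : K) / (π : K) ^ n‖ ≤ 1
      rw [norm_div]
      exact div_le_one_of_le₀ h (norm_nonneg _)
    · push_cast
      field_simp

theorem spectralNorm_irreducible_lt_one {π : integers p K} (hπ : Irreducible π) :
    spectralNorm ℚ_[p] K π < 1 := by
  let := spectralNorm.normedField ℚ_[p] K
  have hnorm (y : K) : spectralNorm ℚ_[p] K y = ‖y‖ := rfl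
  have hπ0 : (π : K) ≠ 0 := fun h => hπ.ne_zero (Subtype.ext h)
  refine lt_of_le_of_ne π.2 fun h => hπ.not_isUnit ?_
  rw [hnorm] at h
  refine IsUnit.of_mul_eq_one ⟨(π : K)⁻¹, ?_⟩ (Subtype.ext ?_)
  · change ‖(π : K)⁻¹‖ ≤ 1
    rw [norm_inv, h, inv_one]
  · exact mul_inv_cancel₀ hπ0

/-- The ring of integers is complete for the topology of its maximal ideal. -/
instance isAdicComplete_integers : IsAdicComplete (maximalIdeal (integers p K)) (integers p K) where
  prec' f hf := by
    let := spectralNorm.normedField ℚ_[p] K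
    have : CompleteSpace K := spectralNorm.completeSpace ℚ_[p] K
    have hnorm (y : K) : spectralNorm ℚ_[p] K y = ‖y‖ := rfl
    obtain ⟨π, hπ⟩ := IsDiscreteValuationRing.exists_irreducible (integers p K)
    have hlt := spectralNorm_irreducible_lt_one p K hπ
    have key (m n : ℕ) (hmn : m ≤ n) : ‖(f m : K) - f n‖ ≤ ‖(π : K)‖ ^ m := by
      have := hf hmn
      rw [smul_eq_mul, Ideal.mul_top, SModEq.sub_mem, mem_maximalIdeal_pow_iff p K hπ] at this
      exact this
    have hc : CauchySeq fun n => (f n : K) :=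
      cauchySeq_of_le_geometric ‖(π : K)‖ 1 hlt fun n => by
        rw [dist_eq_norm, one_mul]
        exact key n (n + 1) n.le_succ
    obtain ⟨a, ha⟩ := cauchySeq_tendsto_of_complete hc
    have ha1 : ‖a‖ ≤ 1 := le_of_tendsto ha.norm (.of_forall fun n => (f n).2)
    refine ⟨⟨a, ha1⟩, fun n => ?_⟩
    rw [smul_eq_mul, Ideal.mul_top, SModEq.sub_mem, mem_maximalIdeal_pow_iff p K hπ]
    exact le_of_tendsto (ha.const_sub (f n : K)).norm
      (Filter.eventually_atTop.2 ⟨n, fun m hm => key n m hm⟩)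

instance henselianLocalRing_integers : HenselianLocalRing (integers p K) where
  is_henselian f hf a h1 h2 := HenselianRing.is_henselian f hf a h1 (h2.map _)

/-- `𝔬` is the integral closure of `ℤ_p` in `K`, hence free of rank `d` over `ℤ_p`, and `𝔬/p` is a
`d`-dimensional `𝔽_p`-space. -/
theorem natCard_quotient_prime :
    Nat.card (integers p K ⧸ Ideal.span {(p : integers p K)}) =
      p ^ Module.finrank ℚ_[p] K := by
  let : Algebra ℤ_[p] K := ((algebraMap ℚ_[p] K).comp (algebraMap ℤ_[p] ℚ_[p])).toAlgebra
  have : IsScalarTower ℤ_[p] ℚ_[p] K := IsScalarTower.of_algebraMap_eq' rfl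
  have : CharZero K := charZero p K
  have hmem (a : ℤ_[p]) : algebraMap ℤ_[p] K a ∈ integers p K := by
    change spectralNorm ℚ_[p] K (algebraMap ℚ_[p] K (a : ℚ_[p])) ≤ 1
    rw [spectralNorm_extends]
    exact a.2
  let : Algebra ℤ_[p] (integers p K) :=
    ((algebraMap ℤ_[p] K).codRestrict (integers p K).toSubring hmem).toAlgebra
  have : IsScalarTower ℤ_[p] (integers p K) K := IsScalarTower.of_algebraMap_eq' rfl
  have : IsIntegralClosure (integers p K) ℤ_[p] K :=
    { algebraMap_injective := FaithfulSMul.algebraMap_injective _ _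
      isIntegral_iff := fun {x} => by
        constructor
        · intro hx
          have : IsIntegral (integers p K) x := hx.tower_top
          exact IsIntegrallyClosed.isIntegral_iff.mp this
        · rintro ⟨y, rfl⟩
          exact isIntegralElem_of_mem_integers p K y.2 }
  have : Module.IsTorsionFree ℤ_[p] K := .trans_faithfulSMul _ ℚ_[p] _
  have : Module.Finite ℤ_[p] (integers p K) := IsIntegralClosure.finite ℤ_[p] ℚ_[p] K _
  have : Module.Free ℤ_[p] (integers p K) := IsIntegralClosure.module_free ℤ_[p] ℚ_[p] K _
  have hI : (maximalIdeal ℤ_[p]).map (algebraMap ℤ_[p] (integers p K)) =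
      Ideal.span {(p : integers p K)} := by
    rw [PadicInt.maximalIdeal_eq_span_p, Ideal.map_span, Set.image_singleton, map_natCast]
  let := Ideal.Quotient.field (maximalIdeal ℤ_[p])
  have hcard : Nat.card (ℤ_[p] ⧸ maximalIdeal ℤ_[p]) = p :=
    (Nat.card_congr (PadicInt.residueField (p := p)).toEquiv).trans (Nat.card_zmod p)
  rw [← hI, Module.natCard_eq_pow_finrank (K := ℤ_[p] ⧸ maximalIdeal ℤ_[p]), hcard,
    finrank_quotient_map, IsIntegralClosure.rank ℤ_[p] ℚ_[p] K]

theorem finite_quotient_prime : Finite (integers p K ⧸ Ideal.span {(p : integers p K)}) :=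
  Nat.finite_of_card_ne_zero (by
    rw [natCard_quotient_prime]
    exact pow_ne_zero _ (Fact.out : p.Prime).ne_zero)

theorem natCast_prime_mem_maximalIdeal : (p : integers p K) ∈ maximalIdeal (integers p K) :=
  natCast_prime_not_isUnit p K

instance finite_residueField : Finite (ResidueField (integers p K)) :=
  have := finite_quotient_prime p K
  Finite.of_surjective (Ideal.Quotient.factor
    ((Ideal.span_singleton_le_iff_mem _).2 (natCast_prime_mem_maximalIdeal p K)))
    (Ideal.Quotient.factor_surjective _)

theorem charP_residueField : CharP (ResidueField (integers p K)) p :=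
  (CharP.charP_iff_prime_eq_zero Fact.out).2 <| by
    rw [← map_natCast (residue (integers p K)), residue_eq_zero_iff]
    exact natCast_prime_mem_maximalIdeal p K

end Base

end LocalDisc

/-! ### Stickelberger's congruence. -/

section Stickelberger

/-- **Stickelberger's congruence**: the discriminant of a family of integral elements is a square
modulo `4`. -/
theorem Algebra.exists_discr_eq_sq_sub_four_mul (R : Type*) {K L ι : Type*} [CommRing R]
    [IsDomain R] [IsIntegrallyClosed R] [Field K] [CharZero K] [Algebra R K] [IsFractionRing R K]
    [Field L] [Algebra K L] [Algebra R L] [IsScalarTower R K L] [FiniteDimensional K L]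
    [Fintype ι] [DecidableEq ι] (hι : Fintype.card ι = Module.finrank K L)
    (b : ι → L) (hb : ∀ i, IsIntegral R (b i)) :
    ∃ s t : R, Algebra.discr K b = algebraMap R K (s ^ 2 - 4 * t) := by
  let E := AlgebraicClosure K
  have : CharZero E := charZero_of_injective_algebraMap (algebraMap K E).injective
  have e : ι ≃ (L →ₐ[K] E) := Fintype.equivOfCardEq (by rw [hι, AlgHom.card])
  set M := Algebra.embeddingsMatrixReindex K E b e
  have hMij (i j : ι) : M i j = e j (b i) := rfl
  have hMint (i j : ι) : IsIntegral R (M i j) :=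
    (hb i).map ((e j).restrictScalars R)
  have hprod (σ : Equiv.Perm ι) : IsIntegral R (∏ i, M (σ i) i) :=
    Subalgebra.prod_mem (integralClosure R E) fun i _ => hMint _ _
  have hdisc : algebraMap K E (Algebra.discr K b) = M.det ^ 2 :=
    Algebra.discr_eq_det_embeddingsMatrixReindex_pow_two K E b e
  -- Even and odd parts of the Leibniz expansion: the determinant is `P - N`, the permanent is `P +
  -- N`, and `(P - N)² = (P + N)² - 4PN`.
  let P : E := ∑ σ : Equiv.Perm ι, if Equiv.Perm.sign σ = 1 then ∏ i, M (σ i) i else 0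
  let N : E := ∑ σ : Equiv.Perm ι, if Equiv.Perm.sign σ = 1 then 0 else ∏ i, M (σ i) i
  have hP : IsIntegral R P := IsIntegral.sum _ fun σ _ => by
    split_ifs
    exacts [hprod σ, isIntegral_zero]
  have hN : IsIntegral R N := IsIntegral.sum _ fun σ _ => by
    split_ifs
    exacts [isIntegral_zero, hprod σ]
  have hdet : M.det = P - N := by
    rw [Matrix.det_apply, ← Finset.sum_sub_distrib]
    refine Finset.sum_congr rfl fun σ _ => ?_
    rcases Int.units_eq_one_or (Equiv.Perm.sign σ) with h | h <;> simp [h]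
  have hperm : M.permanent = P + N := by
    rw [Matrix.permanent, ← Finset.sum_add_distrib]
    refine Finset.sum_congr rfl fun σ _ => ?_
    split_ifs <;> simp
  -- An automorphism of `E` over `K` permutes the embeddings, hence the columns of `M`; the
  -- permanent is insensitive to this.
  have hfix (g : E ≃ₐ[K] E) : g M.permanent = M.permanent := by
    let π : Equiv.Perm ι := Equiv.ofBijective (fun j => e.symm ((g : E →ₐ[K] E).comp (e j)))
      (Finite.injective_iff_bijective.1 fun j k hjk => e.injective <| AlgHom.ext fun x =>
        g.injective (DFunLike.congr_fun (e.symm.injective hjk) x))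
    have hπ (i j : ι) : g (M i j) = M i (π j) := by
      rw [hMij, hMij]
      simp [π]
    conv_rhs => rw [← Matrix.permanent_permute_rows π]
    simp only [Matrix.permanent, map_sum, map_prod, hπ, Matrix.submatrix_apply]
    rfl
  obtain ⟨s', hs'⟩ : M.permanent ∈ Set.range (algebraMap K E) :=
    (InfiniteGalois.mem_range_algebraMap_iff_fixed M.permanent).2 hfix
  have hperm_int : IsIntegral R (algebraMap K E s') := by
    rw [hs', hperm]
    exact hP.add hN
  -- This is `PN`, written so as to lie visibly in `K`; its integrality comes from `P` and `N`.
  let t' : K := (s' ^ 2 - Algebra.discr K b) / 4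
  have ht' : algebraMap K E t' = P * N := by
    simp only [t', map_div₀, map_sub, map_pow, hs', hdisc, hdet, hperm, map_ofNat]
    ring
  have hinj := (algebraMap K E).injective
  obtain ⟨s, hs⟩ := IsIntegrallyClosed.isIntegral_iff.1 ((isIntegral_algebraMap_iff hinj).1 hperm_int)
  obtain ⟨t, ht⟩ := IsIntegrallyClosed.isIntegral_iff.1
    ((isIntegral_algebraMap_iff hinj).1 (ht' ▸ hP.mul hN))
  refine ⟨s, t, ?_⟩
  simp only [map_sub, map_mul, map_pow, map_ofNat, hs, ht, t']
  ring

end Stickelberger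

/-! ### Discriminants of cyclic extensions. -/

section Cyclic

/-- For a cyclic extension of degree `r`, the discriminant of a basis is a square if and only if
`r` is odd. -/
theorem Algebra.isSquare_discr_iff_odd_of_orderOf_eq {K L ι : Type*} [Field K] [CharZero K]
    [Field L] [Algebra K L] [FiniteDimensional K L] [Fintype ι] [DecidableEq ι]
    (σ : L ≃ₐ[K] L) (hσ : orderOf σ = Module.finrank K L) (b : Module.Basis ι K L) :
    IsSquare (Algebra.discr K b) ↔ Odd (Module.finrank K L) := by
  obtain ⟨n, hn⟩ : ∃ n, Module.finrank K L = n + 1 :=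
    Nat.exists_eq_succ_of_ne_zero Module.finrank_pos.ne'
  rw [hn] at hσ ⊢
  have hcard : Nat.card (L ≃ₐ[K] L) = n + 1 := by
    refine le_antisymm ?_ (hσ ▸ orderOf_le_card)
    rw [← hn, Nat.card_eq_fintype_card]
    exact AlgEquiv.card_le
  have : IsGalois K L := IsGalois.of_card_aut_eq_finrank K L (by rw [hcard, hn])
  -- Listing the group as successive powers of `σ` makes `σ` act on columns as `finRotate (n + 1)`,
  -- of sign `(-1)^n`.
  let e : Fin (n + 1) → (L ≃ₐ[K] L) := fun i => σ ^ (i : ℕ)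
  have he : Function.Bijective e := by
    refine (Nat.bijective_iff_injective_and_card e).2 ⟨fun i j hij => Fin.ext ?_,
      by rw [hcard, Nat.card_fin]⟩
    exact pow_injOn_Iio_orderOf (by simpa [hσ] using i.is_le) (by simpa [hσ] using j.is_le) hij
  have hgen (x : L) (hx : σ x = x) : x ∈ Set.range (algebraMap K L) := by
    refine (IsGalois.mem_range_algebraMap_iff_fixed x).2 fun τ => ?_
    obtain ⟨i, rfl⟩ := he.2 τ
    change (σ ^ (i : ℕ)) x = x
    induction (i : ℕ) with
    | zero => simp
    | succ m ih => rw [pow_succ', AlgEquiv.mul_apply, ih, hx]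
  let f : ι ≃ Fin (n + 1) := Fintype.equivOfCardEq (by
    rw [Fintype.card_fin, ← hn, Module.finrank_eq_card_basis b])
  let c := b.reindex f
  have hc : Algebra.discr K c = Algebra.discr K b := by
    simp only [c, Module.Basis.coe_reindex, Algebra.discr_reindex]
  rw [← hc]
  let M : Matrix (Fin (n + 1)) (Fin (n + 1)) L := .of fun i j => e j (c i)
  have hdisc : algebraMap K L (Algebra.discr K c) = M.det ^ 2 := by
    have hsq : M.det ^ 2 = (M * M.transpose).det := by
      rw [Matrix.det_mul, Matrix.det_transpose, sq]
    rw [Algebra.discr_def, RingHom.map_det, hsq]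
    congr 1
    ext i j
    simp only [RingHom.mapMatrix_apply, Matrix.map_apply, Algebra.traceMatrix_apply,
      Algebra.traceForm_apply, trace_eq_sum_automorphisms, Matrix.mul_apply,
      Matrix.transpose_apply, M, Matrix.of_apply, map_mul]
    exact (Fintype.sum_bijective e he _ (fun τ : L ≃ₐ[K] L => τ (c i) * τ (c j)) fun _ => rfl).symm
  have hstep (j : Fin (n + 1)) : σ * e j = e (finRotate (n + 1) j) := by
    simp only [e]
    rw [← pow_succ', finRotate_apply, Fin.val_add, ← pow_mod_orderOf σ (j + 1), hσ]
    simp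
  have hdet : σ M.det = (-1) ^ n * M.det := by
    have h := Matrix.det_permute' (finRotate (n + 1)) M
    rw [sign_finRotate] at h
    push_cast at h
    rw [← h]
    change (σ : L →+* L) M.det = _
    rw [RingHom.map_det]
    congr 1
    ext i j
    change (σ * e j) (c i) = e (finRotate (n + 1) j) (c i)
    rw [hstep]
  have hne : M.det ≠ 0 := fun h => Algebra.discr_not_zero_of_basis K c
    ((algebraMap K L).injective (by rw [hdisc, h]; simp))
  have : CharZero L := charZero_of_injective_algebraMap (algebraMap K L).injective
  rw [Nat.odd_add_one, Nat.not_odd_iff_even]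
  constructor
  · rintro ⟨y, hy⟩
    by_contra hodd
    rw [Nat.not_even_iff_odd] at hodd
    have hsq : M.det ^ 2 = algebraMap K L y ^ 2 := by rw [← hdisc, hy, map_mul, pow_two]
    -- A square discriminant puts `M.det = ±y` in `K`, whereas for odd `n` the generator `σ` negates
    -- it.
    have hfix : σ M.det = M.det := by
      rcases sq_eq_sq_iff_eq_or_eq_neg.1 hsq with h | h <;> simp [h]
    rw [hdet, hodd.neg_one_pow] at hfix
    exact hne (self_eq_neg.1 (by linear_combination -hfix))
  · intro heven
    rw [heven.neg_one_pow, one_mul] at hdet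
    obtain ⟨y, hy⟩ := hgen _ hdet
    refine ⟨y, (algebraMap K L).injective ?_⟩
    rw [hdisc, map_mul, hy, pow_two]

end Cyclic

/-! ### Unramified algebras: unit discriminant and lifted Frobenius. -/

section Etale

open IsLocalRing

variable {R S : Type*} [CommRing R] [CommRing S] [Algebra R S] [IsLocalRing R] [IsLocalRing S]
  [IsLocalHom (algebraMap R S)] [Finite (ResidueField R)]

/-- The discriminant of a basis of a finite unramified local algebra with finite residue fields is
a unit. -/
theorem Algebra.isUnit_discr_of_formallyUnramified {ι : Type*} [Fintype ι] [DecidableEq ι]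
    [Module.Finite R S] [Module.Free R S] [Algebra.FormallyUnramified R S]
    (b : Module.Basis ι R S) : IsUnit (Algebra.discr R b) := by
  let := Ideal.Quotient.field (maximalIdeal R)
  let : Field (S ⧸ (maximalIdeal R).map (algebraMap R S)) :=
    (Algebra.FormallyUnramified.isField_quotient_map_maximalIdeal (R := R) (S := S)).toField
  have : Finite (R ⧸ maximalIdeal R) := ‹Finite (ResidueField R)›
  have := Module.Finite.of_basis (basisQuotient b)
  -- Modulo the maximal ideal `S` becomes a finite extension of a finite field, hence separable, and
  -- its trace form is nondegenerate.
  have h := Algebra.discr_not_zero_of_basis (R ⧸ maximalIdeal R) (basisQuotient b)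
  by_contra hu
  refine h ?_
  have : Ideal.Quotient.mk (maximalIdeal R) (Algebra.discr R b) = 0 :=
    Ideal.Quotient.eq_zero_iff_mem.2 hu
  rw [← this, Algebra.discr_def, Algebra.discr_def, RingHom.map_det]
  congr 1
  ext i j
  simp only [RingHom.mapMatrix_apply, Matrix.map_apply, Algebra.traceMatrix_apply,
    Algebra.traceForm_apply, basisQuotient_apply, ← map_mul]
  exact Algebra.trace_quotient_mk _

/-- A finite étale extension of complete local rings with finite residue fields has an
automorphism whose order is the degree: a lift of Frobenius. -/
theorem exists_orderOf_eq_finrank_of_etale (K L : Type*) [IsDomain R] [IsIntegrallyClosed R]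
    [IsDomain S] [Field K] [Field L] [Algebra R K] [IsFractionRing R K] [Algebra S L]
    [Algebra K L] [Algebra R L] [IsScalarTower R K L] [IsScalarTower R S L]
    [IsIntegralClosure S R L] [FiniteDimensional K L]
    [Module.Finite R S] [Algebra.Etale R S] [IsAdicComplete (maximalIdeal S) S]
    (hfin : Module.finrank R S = Module.finrank K L) :
    ∃ σ : L ≃ₐ[K] L, orderOf σ = Module.finrank K L := by
  have := Fintype.ofFinite (ResidueField R)
  have : Finite (ResidueField S) := Module.finite_of_finite (ResidueField R)
  let F := FiniteField.frobeniusAlgHom (ResidueField R) (ResidueField S)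
  -- Formal smoothness and completeness of `S` lift the map `S → ResidueField S` given by reduction
  -- followed by Frobenius.
  obtain ⟨g, hg⟩ := Algebra.FormallySmooth.exists_mkₐ_comp_eq_of_isAdicComplete
    (I := maximalIdeal S) (((F.restrictScalars R).comp (IsScalarTower.toAlgHom R S (ResidueField S))))
  replace hg (x : S) : residue S (g x) = F (residue S x) := DFunLike.congr_fun hg x
  have hpow (m : ℕ) (x : S) : residue S ((g ^ m) x) = (F ^ m) (residue S x) := by
    induction m with
    | zero => simp
    | succ m ih => rw [pow_succ', pow_succ', AlgHom.mul_apply, AlgHom.mul_apply, hg, ih]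
  have hF : orderOf F = Module.finrank K L := by
    rw [FiniteField.orderOf_frobeniusAlgHom, ← finrank_eq_finrank_residueField, hfin]
  let τ : L →ₐ[K] L := (galRestrictHom R K L S).symm g
  let σ : L ≃ₐ[K] L := (Algebra.IsAlgebraic.algEquivEquivAlgHom K L).symm τ
  have hord : orderOf σ = orderOf g := by
    rw [MulEquiv.orderOf_eq, MulEquiv.orderOf_eq]
  refine ⟨σ, le_antisymm ?_ ?_⟩
  · refine orderOf_le_card.trans ?_
    rw [Nat.card_eq_fintype_card]
    exact AlgEquiv.card_le
  -- The order of Frobenius, equal to the degree, divides that of its lift; the number of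
  -- automorphisms gives the opposite bound.
  · refine Nat.le_of_dvd (orderOf_pos σ) ?_
    rw [hord, ← hF]
    refine orderOf_dvd_of_pow_eq_one (AlgHom.ext fun x => ?_)
    obtain ⟨x, rfl⟩ := residue_surjective x
    rw [← hpow, pow_orderOf_eq_one]
    rfl

end Etale

namespace LocalDisc

open IsLocalRing

/-! ### Application to rings of integers of extensions. -/

section Extension

variable (p : ℕ) [Fact p.Prime] (K : Type*) [Field K] [Algebra ℚ_[p] K]
  [FiniteDimensional ℚ_[p] K] (L : Type*) [Field L] [Algebra K L]

/-- Elements of norm at most `1` are integral over `ℤ_p`, and `integers p L` is integrally closed.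
This transfers locality and completeness, known for `integers p L`, to `extIntegers p K L`. -/
theorem mem_extIntegers_iff [Algebra ℚ_[p] L] [IsScalarTower ℚ_[p] K L]
    [FiniteDimensional ℚ_[p] L] (x : L) : x ∈ extIntegers p K L ↔ x ∈ integers p L := by
  have hmem (a : integers p K) : algebraMap K L a ∈ integers p L := by
    rw [mem_integers_iff, ← spectralNorm.eq_of_tower]
    exact a.2
  let f : integers p K →+* integers p L :=
    ((algebraMap K L).comp (integers p K).subtype).codRestrict (integers p L).toSubring hmem
  constructor
  · rintro ⟨q, hq, hx⟩
    have : IsIntegral (integers p L) x := ⟨q.map f, hq.map f, by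
      rw [Polynomial.eval₂_map]
      exact hx⟩
    obtain ⟨y, rfl⟩ := IsIntegrallyClosed.isIntegral_iff.1 this
    exact y.2
  · intro hx
    obtain ⟨q, hq, hx⟩ := isIntegralElem_of_mem_integers p L hx
    have hmem' (a : ℤ_[p]) : algebraMap ℚ_[p] K a ∈ integers p K := by
      rw [mem_integers_iff, spectralNorm_extends]
      exact a.2
    let g : ℤ_[p] →+* integers p K :=
      ((algebraMap ℚ_[p] K).comp (algebraMap ℤ_[p] ℚ_[p])).codRestrict
        (integers p K).toSubring hmem'
    refine ⟨q.map g, hq.map g, ?_⟩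
    rw [Polynomial.eval₂_map]
    convert hx using 2
    ext a
    exact (IsScalarTower.algebraMap_apply ℚ_[p] K L _).symm

/-- The integral closure of `𝔬` in `L` is the ring of integers of `L`, seen as an extension of
`ℚ_p`. -/
noncomputable def extIntegersEquiv [Algebra ℚ_[p] L] [IsScalarTower ℚ_[p] K L]
    [FiniteDimensional ℚ_[p] L] : integers p L ≃+* extIntegers p K L where
  toFun x := ⟨x, (mem_extIntegers_iff p K L x).2 x.2⟩
  invFun x := ⟨x, (mem_extIntegers_iff p K L x).1 x.2⟩
  left_inv _ := rfl
  right_inv _ := rfl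
  map_mul' _ _ := rfl
  map_add' _ _ := rfl

variable [FiniteDimensional K L]

theorem isLocalRing_and_isAdicComplete_extIntegers :
    ∃ _ : IsLocalRing (extIntegers p K L),
      IsAdicComplete (maximalIdeal (extIntegers p K L)) (extIntegers p K L) := by
  let : Algebra ℚ_[p] L := ((algebraMap K L).comp (algebraMap ℚ_[p] K)).toAlgebra
  have : IsScalarTower ℚ_[p] K L := IsScalarTower.of_algebraMap_eq' rfl
  have : FiniteDimensional ℚ_[p] L := FiniteDimensional.trans ℚ_[p] K L
  let e := extIntegersEquiv p K L
  have hloc : IsLocalRing (extIntegers p K L) := RingEquiv.isLocalRing e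
  refine ⟨hloc, ?_⟩
  have h := (IsAdicComplete.congr_ringEquiv (maximalIdeal (integers p L)) e).2 inferInstance
  rwa [IsLocalRing.eq_maximalIdeal (Ideal.map_isMaximal_of_equiv e)] at h

instance isLocalRing_extIntegers : IsLocalRing (extIntegers p K L) :=
  (isLocalRing_and_isAdicComplete_extIntegers p K L).1

instance isAdicComplete_extIntegers :
    IsAdicComplete (maximalIdeal (extIntegers p K L)) (extIntegers p K L) :=
  (isLocalRing_and_isAdicComplete_extIntegers p K L).2

theorem finrank_extIntegers :
    Module.finrank (integers p K) (extIntegers p K L) = Module.finrank K L := by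
  have := charZero p K
  have : Module.IsTorsionFree (integers p K) L := .trans_faithfulSMul _ K _
  exact IsIntegralClosure.rank (integers p K) K L _

/-- The discriminant of a basis of integers is a square modulo `4`. -/
theorem exists_discr_eq_sq_sub_four_mul {ι : Type*} [Fintype ι] [DecidableEq ι]
    (b : Module.Basis ι (integers p K) (extIntegers p K L)) :
    ∃ s t : integers p K, Algebra.discr (integers p K) b = s ^ 2 - 4 * t := by
  have := charZero p K
  obtain ⟨s, t, h⟩ := Algebra.exists_discr_eq_sq_sub_four_mul (integers p K) (K := K)
    (by rw [← Module.finrank_eq_card_basis b, finrank_extIntegers]) (fun i => (b i : L))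
    fun i => (b i).2
  rw [discr_basis_eq p K L b] at h
  exact ⟨s, t, FaithfulSMul.algebraMap_injective _ K h⟩

variable {K L}

theorem isUnit_discr_of_isUnramified (h : IsUnramified p K L) {ι : Type*} [Fintype ι]
    [DecidableEq ι] (b : Module.Basis ι (integers p K) (extIntegers p K L)) :
    IsUnit (Algebra.discr (integers p K) b) := by
  have : Algebra.FormallyUnramified (integers p K) (extIntegers p K L) := h
  exact Algebra.isUnit_discr_of_formallyUnramified b

theorem isSquare_discr_iff_odd_of_isUnramified (h : IsUnramified p K L) {ι : Type*} [Fintype ι]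
    [DecidableEq ι] (b : Module.Basis ι (integers p K) (extIntegers p K L)) :
    IsSquare (Algebra.discr K fun i => (b i : L)) ↔ Odd (Module.finrank K L) := by
  have := charZero p K
  have : Algebra.FormallyUnramified (integers p K) (extIntegers p K L) := h
  have : Algebra.FinitePresentation (integers p K) (extIntegers p K L) :=
    Algebra.FinitePresentation.of_finiteType.1 inferInstance
  have : Algebra.Etale (integers p K) (extIntegers p K L) := .of_formallyUnramified_of_flat
  obtain ⟨σ, hσ⟩ := exists_orderOf_eq_finrank_of_etale (R := integers p K)
    (S := extIntegers p K L) K L (finrank_extIntegers p K L)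
  have : IsLocalization (Algebra.algebraMapSubmonoid (extIntegers p K L)
      (nonZeroDivisors (integers p K))) L :=
    IsIntegralClosure.isLocalization (integers p K) K L _
  have := Algebra.isSquare_discr_iff_odd_of_orderOf_eq σ hσ
    (b.localizationLocalization K (nonZeroDivisors (integers p K)) L)
  convert this using 3
  ext i
  simp [Module.Basis.localizationLocalization_apply]

end Extension

end LocalDisc

/-! ### The equation `z² + z = c` over a finite field. -/

section FiniteField

variable {F : Type*} [Field F]

/-- Completing the square: `(1 + 2z)² = 1 + 4(z² + z)`. Away from characteristic two the equation
thus reduces to the quadratic character. -/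
theorem exists_sq_add_self_eq_iff_isSquare (hF : (2 : F) ≠ 0) (c : F) :
    (∃ z, z ^ 2 + z = c) ↔ IsSquare (1 + 4 * c) := by
  constructor
  · rintro ⟨z, rfl⟩
    exact ⟨1 + 2 * z, by ring⟩
  · rintro ⟨w, hw⟩
    refine ⟨(w - 1) / 2, ?_⟩
    field_simp
    linear_combination -hw

variable [Finite F]

theorem FiniteField.isSquare_mul_of_not_isSquare {a b : F} (ha : ¬ IsSquare a) (hb : ¬ IsSquare b) :
    IsSquare (a * b) := by
  classical
  have := Fintype.ofFinite F
  have hF : ringChar F ≠ 2 := fun h => ha (FiniteField.isSquare_of_char_two h a)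
  have hab : a * b ≠ 0 := mul_ne_zero (fun h => ha (by simp [h])) (fun h => hb (by simp [h]))
  rw [← quadraticChar_one_iff_isSquare hab, map_mul,
    quadraticChar_neg_one_iff_not_isSquare.2 ha, quadraticChar_neg_one_iff_not_isSquare.2 hb]
  norm_num

/-- The Artin–Schreier map `z ↦ z ^ 2 + z` in characteristic two. -/
def artinSchreierTwo (F : Type*) [CommRing F] [CharP F 2] : F →+ F where
  toFun z := z ^ 2 + z
  map_zero' := by simp
  map_add' x y := by rw [CharTwo.add_sq]; ring

/-- The kernel is `{0, 1}`, and on a finite group the index of the range is the order of the kernel.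
-/
theorem index_range_artinSchreierTwo [CharP F 2] : (artinSchreierTwo F).range.index = 2 := by
  have hker : ((artinSchreierTwo F).ker : Set F) = {0, 1} := by
    ext z
    have : z ^ 2 + z = z * (z - 1) := by rw [CharTwo.sub_eq_add]; ring
    change z ^ 2 + z = 0 ↔ _
    rw [this, mul_eq_zero, sub_eq_zero]
    rfl
  have hcard : Nat.card (artinSchreierTwo F).ker = 2 := by
    rw [← SetLike.coe_sort_coe, hker, Nat.card_coe_set_eq, Set.ncard_pair zero_ne_one]
  have h1 := (artinSchreierTwo F).ker.card_mul_index
  have h2 := (artinSchreierTwo F).range.card_mul_index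
  rw [AddSubgroup.index_ker, hcard, ← h2, mul_comm] at h1
  exact (Nat.eq_of_mul_eq_mul_left Nat.card_pos h1).symm

/-- Supplies the nontrivial class `u`. The condition `1 + 4c ≠ 0`, automatic in characteristic two,
ensures that `1 + 4c` lifts to a unit. -/
theorem exists_one_add_four_mul_ne_zero_and_forall_sq_add_self_ne :
    ∃ c : F, 1 + 4 * c ≠ 0 ∧ ∀ z, z ^ 2 + z ≠ c := by
  by_cases h2 : (2 : F) = 0
  · have : CharP F 2 := CharTwo.of_one_ne_zero_of_two_eq_zero one_ne_zero h2
    have h4 : (4 : F) = 0 := by linear_combination 2 * h2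
    by_contra! h
    have htop : (artinSchreierTwo F).range = ⊤ := by
      rw [eq_top_iff]
      exact fun c _ => h c (by simp [h4])
    have := index_range_artinSchreierTwo (F := F)
    rw [htop, AddSubgroup.index_top] at this
    omega
  · have hF : ringChar F ≠ 2 := fun h => h2 (by exact_mod_cast h ▸ ringChar.Nat.cast_ringChar (R := F))
    obtain ⟨a, ha⟩ := FiniteField.exists_nonsquare hF
    have h4 : (4 : F) ≠ 0 := by
      rw [show (4 : F) = 2 * 2 by norm_num]
      exact mul_ne_zero h2 h2
    have hc : 1 + 4 * ((a - 1) / 4) = a := by field_simp; ring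
    refine ⟨(a - 1) / 4, ?_, ?_⟩
    · rw [hc]
      rintro rfl
      simp at ha
    · rw [← not_exists, exists_sq_add_self_eq_iff_isSquare h2, hc]
      exact ha

/-- Since `(1 + 4c)(1 + 4c') = 1 + 4(c + c' + 4cc')`, this says that two nontrivial classes cancel,
in any characteristic. -/
theorem exists_sq_add_self_eq_of_forall_ne {c c' : F} (hc : ∀ z, z ^ 2 + z ≠ c)
    (hc' : ∀ z, z ^ 2 + z ≠ c') : ∃ z, z ^ 2 + z = c + c' + 4 * c * c' := by
  by_cases h2 : (2 : F) = 0
  · have : CharP F 2 := CharTwo.of_one_ne_zero_of_two_eq_zero one_ne_zero h2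
    have h4 : (4 : F) = 0 := by linear_combination 2 * h2
    have := (AddSubgroup.add_mem_iff_of_index_two
      (index_range_artinSchreierTwo (F := F)) (a := c) (b := c')).2
      (iff_of_false (fun ⟨z, hz⟩ => hc z hz) (fun ⟨z, hz⟩ => hc' z hz))
    obtain ⟨z, hz⟩ := this
    exact ⟨z, by rw [h4, zero_mul, zero_mul, add_zero]; exact hz⟩
  · rw [← not_exists, exists_sq_add_self_eq_iff_isSquare h2] at hc hc'
    rw [exists_sq_add_self_eq_iff_isSquare h2]
    convert FiniteField.isSquare_mul_of_not_isSquare hc hc' using 1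
    ring

end FiniteField

namespace LocalDisc

open IsLocalRing

/-! ### Squares in `1 + 4𝔬` and the line `Ū_{2e}`. -/

section Units

variable (p : ℕ) [Fact p.Prime] (K : Type*) [Field K] [Algebra ℚ_[p] K]
  [FiniteDimensional ℚ_[p] K]

variable {p K} in
theorem mem_unitFiltration_iff (n : ℕ) (x : (integers p K)ˣ) :
    x ∈ unitFiltration p K n ↔ (x : integers p K) - 1 ∈ maximalIdeal (integers p K) ^ n := by
  rw [unitFiltration, MonoidHom.mem_ker, Units.ext_iff, ← Ideal.Quotient.eq_zero_iff_mem, map_sub,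
    map_one, sub_eq_zero]
  rfl

/-- For `p = 2` both sides are `(2)²`; for odd `p` both are the unit ideal. Hence `U_{2e}` can be
treated as `1 + 4𝔬` uniformly. -/
theorem maximalIdeal_pow_two_mul_ramIdx :
    maximalIdeal (integers p K) ^ (2 * ramIdx p K) = Ideal.span {4} := by
  by_cases hp : p = 2
  · subst hp
    obtain ⟨π, hπ⟩ := IsDiscreteValuationRing.exists_irreducible (integers 2 K)
    obtain ⟨n, hn⟩ := IsDiscreteValuationRing.associated_pow_irreducible
      (two_ne_zero (α := integers 2 K)) hπ
    have he : ramIdx 2 K = n := by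
      rw [ramIdx, if_pos rfl, Nat.cast_ofNat,
        (IsDiscreteValuationRing.addVal_eq_iff_associated _ _).2 hn, hπ.addVal_pow]
      rfl
    rw [he, mul_comm, pow_mul, hπ.maximalIdeal_eq, Ideal.span_singleton_pow,
      Ideal.span_singleton_eq_span_singleton.2 hn.symm, Ideal.span_singleton_pow]
    norm_num
  · have h4 : IsUnit (4 : integers p K) := by
      have := charP_residueField p K
      rw [← residue_ne_zero_iff_isUnit, map_ofNat]
      intro h
      have h' : ((4 : ℕ) : ResidueField (integers p K)) = 0 := by exact_mod_cast h
      rw [CharP.cast_eq_zero_iff _ p, show 4 = 2 ^ 2 by norm_num] at h'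
      exact hp ((Nat.prime_dvd_prime_iff_eq Fact.out Nat.prime_two).1
        ((Fact.out : p.Prime).dvd_of_dvd_pow h'))
    rw [ramIdx, if_neg hp, mul_zero, pow_zero, Ideal.span_singleton_eq_top.2 h4,
      Ideal.one_eq_top]

variable {p K} in
theorem mem_unitFiltration_two_mul_ramIdx_iff (x : (integers p K)ˣ) :
    x ∈ unitFiltration p K (2 * ramIdx p K) ↔ ∃ c, (x : integers p K) = 1 + 4 * c := by
  rw [mem_unitFiltration_iff, maximalIdeal_pow_two_mul_ramIdx, Ideal.mem_span_singleton]
  simp only [dvd_def, sub_eq_iff_eq_add']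

variable {p K}

/-- Hensel's lemma for `X² + X - c`: the derivative `2a + 1` is a unit because its square is `1 +
4c` modulo `𝔭`. -/
theorem exists_sq_add_self_eq_of_residue {c a : integers p K}
    (h : residue (integers p K) a ^ 2 + residue (integers p K) a = residue (integers p K) c)
    (hc : IsUnit (1 + 4 * c)) :
    ∃ z : integers p K, z ^ 2 + z = c ∧ z - a ∈ maximalIdeal (integers p K) := by
  have hmonic : (Polynomial.X ^ 2 + Polynomial.X - Polynomial.C c).Monic := by monicity!
  obtain ⟨z, hz, hza⟩ := HenselianLocalRing.is_henselian _ hmonic a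
    (by rw [← residue_eq_zero_iff]; simp [h])
    (by
      rw [← residue_ne_zero_iff_isUnit] at hc ⊢
      intro h0
      apply hc
      have hder : (Polynomial.X ^ 2 + Polynomial.X - Polynomial.C c).derivative.eval a =
          2 * a + 1 := by
        simp [one_add_one_eq_two]
      have hid : 1 + 4 * c = (2 * a + 1) * (2 * a + 1) - 4 * (a ^ 2 + a - c) := by ring
      rw [hder] at h0
      rw [hid, map_sub, map_mul, h0, map_mul, map_sub, map_add, map_pow, h]
      simp)
  refine ⟨z, ?_, hza⟩
  simp only [Polynomial.IsRoot, Polynomial.eval_sub, Polynomial.eval_add, Polynomial.eval_pow,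
    Polynomial.eval_X, Polynomial.eval_C] at hz
  linear_combination hz

theorem isSquare_one_add_four_mul_iff {c : integers p K} (hc : IsUnit (1 + 4 * c)) :
    IsSquare (1 + 4 * c) ↔
      ∃ z : ResidueField (integers p K), z ^ 2 + z = residue (integers p K) c := by
  have := charZero p K
  constructor
  · rintro ⟨w, hw⟩
    have hK : ((w : K) - 1) ^ 2 / 4 + (w - 1) / 2 = c := by
      have : (1 + 4 * c : K) = w * w := congrArg Subtype.val hw
      linear_combination -this / 4
    -- Even when `2` is not a unit, `(w - 1)/2` is integral, being a root of the monic `X² + X - c`.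
    have hint : IsIntegral (integers p K) (((w : K) - 1) / 2) := by
      refine ⟨Polynomial.X ^ 2 + Polynomial.X - Polynomial.C c, by monicity!, ?_⟩
      simp only [Polynomial.eval₂_sub, Polynomial.eval₂_add, Polynomial.eval₂_X_pow,
        Polynomial.eval₂_X, Polynomial.eval₂_C]
      change _ - (c : K) = 0
      linear_combination hK
    obtain ⟨z, hz⟩ := IsIntegrallyClosed.isIntegral_iff.1 hint
    refine ⟨residue _ z, ?_⟩
    rw [← map_pow, ← map_add]
    congr 1
    refine Subtype.ext ?_
    have hz' : (z : K) = (w - 1) / 2 := hz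
    push_cast
    rw [hz']
    linear_combination hK
  · rintro ⟨z, hz⟩
    obtain ⟨a, rfl⟩ := residue_surjective z
    obtain ⟨z, rfl, -⟩ := exists_sq_add_self_eq_of_residue hz hc
    exact ⟨1 + 2 * z, by ring⟩

theorem unitsIncl_injective : Function.Injective (unitsIncl p K) :=
  Units.map_injective (FaithfulSMul.algebraMap_injective (integers p K) K)

theorem isSquare_coe_iff (x : integers p K) : IsSquare (x : K) ↔ IsSquare x := by
  constructor
  · rintro ⟨w, hw⟩
    have hint : IsIntegral (integers p K) w := by
      refine IsIntegral.of_pow two_pos ?_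
      rw [pow_two, ← hw]
      exact isIntegral_algebraMap (x := x)
    obtain ⟨z, rfl⟩ := IsIntegrallyClosed.isIntegral_iff.1 hint
    exact ⟨z, Subtype.ext hw⟩
  · exact fun h => h.map (algebraMap (integers p K) K)

theorem isSquare_units_iff (x : (integers p K)ˣ) : IsSquare x ↔ IsSquare (x : integers p K) := by
  constructor
  · exact fun h => h.map (Units.coeHom _)
  · rintro ⟨w, hw⟩
    have hu : IsUnit w := isUnit_of_mul_isUnit_left (hw ▸ x.isUnit)
    exact ⟨hu.unit, Units.ext hw⟩

/-- The class in `Kˣ/𝔬ˣ²` of a unit of `𝔬`. -/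
noncomputable def unitClass (p : ℕ) [Fact p.Prime] (K : Type*) [Field K] [Algebra ℚ_[p] K]
    [FiniteDimensional ℚ_[p] K] : (integers p K)ˣ →* UnitClasses p K :=
  (QuotientGroup.mk' (unitSquares p K)).comp (unitsIncl p K)

theorem ker_unitClass :
    (unitClass p K).ker = (powMonoidHom 2 : (integers p K)ˣ →* (integers p K)ˣ).range := by
  rw [unitClass, ← MonoidHom.comap_ker, QuotientGroup.ker_mk', unitSquares,
    Subgroup.comap_map_eq_self_of_injective unitsIncl_injective]

theorem unitClass_eq_one_iff (x : (integers p K)ˣ) :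
    unitClass p K x = 1 ↔ IsSquare (x : integers p K) := by
  rw [← MonoidHom.mem_ker, ker_unitClass, ← isSquare_units_iff, isSquare_iff_exists_sq]
  exact exists_congr fun y => eq_comm

theorem unitClass_eq_iff (x y : (integers p K)ˣ) :
    unitClass p K x = unitClass p K y ↔ IsSquare ((x * y : (integers p K)ˣ) : integers p K) := by
  rw [MonoidHom.eq_iff, MonoidHom.mem_ker, unitClass_eq_one_iff, ← isSquare_units_iff,
    ← isSquare_units_iff]
  constructor
  · rintro ⟨w, hw⟩
    exact ⟨y * w, by rw [mul_mul_mul_comm, ← hw, mul_assoc, mul_inv_cancel_left, mul_comm]⟩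
  · rintro ⟨w, hw⟩
    exact ⟨y⁻¹ * w, by rw [mul_mul_mul_comm, ← hw, mul_assoc, mul_comm x, inv_mul_cancel_left]⟩

theorem barU_eq_map (n : ℕ) : barU p K n = (unitFiltration p K n).map (unitClass p K) := by
  rw [barU, unitClass, Subgroup.map_map]

theorem unitFiltration_zero : unitFiltration p K 0 = ⊤ := by
  ext x
  simp [mem_unitFiltration_iff]

variable (p K) in
theorem exists_barU_two_mul_ramIdx_eq :
    ∃ u : UnitClasses p K, u ≠ 1 ∧ (barU p K (2 * ramIdx p K) : Set (UnitClasses p K)) = {1, u} := by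
  obtain ⟨c₀, hc₀, hroot⟩ :=
    exists_one_add_four_mul_ne_zero_and_forall_sq_add_self_ne (F := ResidueField (integers p K))
  obtain ⟨c, rfl⟩ := residue_surjective c₀
  have hu : IsUnit (1 + 4 * c) := by
    rw [← residue_ne_zero_iff_isUnit]
    rwa [map_add, map_mul, map_one, map_ofNat]
  have hne : unitClass p K hu.unit ≠ 1 := by
    rw [Ne, unitClass_eq_one_iff, IsUnit.unit_spec, isSquare_one_add_four_mul_iff hu]
    simpa using hroot
  refine ⟨unitClass p K hu.unit, hne, ?_⟩
  rw [barU_eq_map]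
  ext y
  constructor
  · rintro ⟨x, hx, rfl⟩
    obtain ⟨c', hc'⟩ := (mem_unitFiltration_two_mul_ramIdx_iff x).1 hx
    by_cases hsq : IsSquare (x : integers p K)
    · exact Or.inl ((unitClass_eq_one_iff x).2 hsq)
    · right
      refine (unitClass_eq_iff x hu.unit).2 ?_
      have hprod : ((x * hu.unit : (integers p K)ˣ) : integers p K) =
          1 + 4 * (c' + c + 4 * c' * c) := by
        rw [Units.val_mul, IsUnit.unit_spec, hc']
        ring
      rw [hprod, isSquare_one_add_four_mul_iff (hprod ▸ Units.isUnit _)]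
      rw [hc', isSquare_one_add_four_mul_iff (hc' ▸ x.isUnit), not_exists] at hsq
      rw [map_add, map_add, map_mul, map_mul, map_ofNat]
      exact exists_sq_add_self_eq_of_forall_ne hsq hroot
  · rintro (rfl | rfl)
    · exact one_mem _
    · exact ⟨_, (mem_unitFiltration_two_mul_ramIdx_iff _).2 ⟨c, hu.unit_spec⟩, rfl⟩

/-- For `p = 2`, `x` being a unit forces `s` to be one, and `x/s² = 1 - 4t/s²`. For odd `p`, `2e =
0` and nothing is required. -/
theorem unitClass_mem_barU_of_eq_sq_sub {x : (integers p K)ˣ} {s t : integers p K}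
    (h : (x : integers p K) = s ^ 2 - 4 * t) : unitClass p K x ∈ barU p K (2 * ramIdx p K) := by
  rw [barU_eq_map]
  by_cases hp : p = 2
  · subst hp
    have hs : IsUnit s := by
      by_contra hs
      have h2 := natCast_prime_mem_maximalIdeal 2 K
      have hx : (x : integers 2 K) ∈ maximalIdeal (integers 2 K) := by
        rw [h]
        refine sub_mem (Ideal.pow_mem_of_mem _ hs 2 two_pos) ?_
        rw [show (4 : integers 2 K) * t = 2 * t * ((2 : ℕ) : integers 2 K) by push_cast; ring]
        exact Ideal.mul_mem_left _ _ h2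
      exact hx x.isUnit
    refine ⟨x * (hs.unit⁻¹ * hs.unit⁻¹), ?_, ?_⟩
    · refine (mem_unitFiltration_two_mul_ramIdx_iff _).2
        ⟨-t * (↑hs.unit⁻¹ * ↑hs.unit⁻¹), ?_⟩
      have hinv : s * ↑hs.unit⁻¹ = 1 := hs.mul_val_inv
      push_cast
      rw [h]
      linear_combination (s * ↑hs.unit⁻¹ + 1) * hinv
    · refine (unitClass_eq_iff _ _).2 ⟨x * ↑hs.unit⁻¹, ?_⟩
      push_cast
      ring
  · refine ⟨x, ?_, rfl⟩
    rw [ramIdx, if_neg hp, mul_zero, unitFiltration_zero]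
    trivial

end Units

end LocalDisc

namespace LocalDisc

open IsLocalRing

/-! ### The order of `𝔬ˣ/𝔬ˣ²` for `p = 2`. -/

section Count

variable (K : Type*) [Field K] [Algebra ℚ_[2] K] [FiniteDimensional ℚ_[2] K]

variable {K} in
theorem exists_eq_one_add_four_mul_of_eq_one_add_eight_mul {x z : integers 2 K} (hx : IsUnit x)
    (h : x = 1 + 8 * z) : ∃ a, x = (1 + 4 * a) ^ 2 := by
  have h2 : (2 : integers 2 K) ∈ maximalIdeal (integers 2 K) := by
    exact_mod_cast natCast_prime_mem_maximalIdeal 2 K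
  have hx' : x = 1 + 4 * (2 * z) := by rw [h]; ring
  obtain ⟨a, ha, ham⟩ := exists_sq_add_self_eq_of_residue (c := 2 * z) (a := 0)
    (by
      rw [map_zero, (residue_eq_zero_iff _).2 (Ideal.mul_mem_right _ _ h2)]
      ring)
    (hx' ▸ hx)
  rw [sub_zero] at ham
  have hu : IsUnit (1 + a) := by
    by_contra hu
    have : (1 : integers 2 K) ∈ maximalIdeal (integers 2 K) := by
      simpa using sub_mem (show 1 + a ∈ maximalIdeal (integers 2 K) from hu) ham
    exact this isUnit_one
  obtain ⟨v, hv⟩ := hu.exists_left_inv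
  refine ⟨v * z, ?_⟩
  -- From `a(1 + a) = 2z` with `1 + a` a unit, `a` is divisible by `2`, so the root `1 + 2a` of `x`
  -- lies in `1 + 4𝔬`.
  have haz : a = 2 * (v * z) := by linear_combination v * ha - a * hv
  rw [hx', ← ha]
  have : (1 + 4 * (v * z)) = 1 + 2 * a := by rw [haz]; ring
  rw [this]
  ring

/-- The units congruent to `1` modulo `4`. -/
noncomputable abbrev unitsModFour : Subgroup (integers 2 K)ˣ := unitFiltration 2 K (2 * ramIdx 2 K)

/-- The homomorphism `1 + 4c ↦ c mod 2`. -/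
noncomputable def unitsModFourQuotient :
    unitsModFour K →* Multiplicative (integers 2 K ⧸ Ideal.span {((2 : ℕ) : integers 2 K)}) :=
  MonoidHom.mk' (fun x => Multiplicative.ofAdd (Ideal.Quotient.mk _
    ((mem_unitFiltration_two_mul_ramIdx_iff _).1 x.2).choose)) fun x y => by
  rw [← ofAdd_add, ← map_add]
  refine congrArg _ (Ideal.Quotient.eq.2 (Ideal.mem_span_singleton'.2 ?_))
  have hx := ((mem_unitFiltration_two_mul_ramIdx_iff _).1 x.2).choose_spec
  have hy := ((mem_unitFiltration_two_mul_ramIdx_iff _).1 y.2).choose_spec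
  have hxy := ((mem_unitFiltration_two_mul_ramIdx_iff _).1 (x * y).2).choose_spec
  set a := ((mem_unitFiltration_two_mul_ramIdx_iff _).1 x.2).choose
  set b := ((mem_unitFiltration_two_mul_ramIdx_iff _).1 y.2).choose
  set c := ((mem_unitFiltration_two_mul_ramIdx_iff _).1 (x * y).2).choose
  -- `(1 + 4a)(1 + 4b) = 1 + 4(a + b + 4ab)`, and the error `4ab` is `2ab` times `2`.
  refine ⟨2 * a * b, mul_left_cancel₀ (OfNat.ofNat_ne_zero 4 : (4 : integers 2 K) ≠ 0) ?_⟩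
  have hmul : ((x * y : unitsModFour K) : (integers 2 K)ˣ) =
      ((x : (integers 2 K)ˣ) : integers 2 K) * ((y : (integers 2 K)ˣ) : integers 2 K) := by
    simp
  rw [hx, hy, hxy] at hmul
  push_cast
  linear_combination -hmul

variable {K}

theorem unitsModFourQuotient_apply (x : unitsModFour K) {c : integers 2 K}
    (h : ((x : (integers 2 K)ˣ) : integers 2 K) = 1 + 4 * c) :
    unitsModFourQuotient K x = Multiplicative.ofAdd (Ideal.Quotient.mk _ c) := by
  refine congrArg (fun a => Multiplicative.ofAdd (Ideal.Quotient.mk _ a))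
    (mul_left_cancel₀ (OfNat.ofNat_ne_zero 4 : (4 : integers 2 K) ≠ 0) ?_)
  have hx := ((mem_unitFiltration_two_mul_ramIdx_iff _).1 x.2).choose_spec
  exact add_left_cancel (hx.symm.trans h)

theorem isUnit_one_add_four_mul (c : integers 2 K) : IsUnit (1 + 4 * c) := by
  by_contra h
  have h2 := natCast_prime_mem_maximalIdeal 2 K
  have h4 : 4 * c ∈ maximalIdeal (integers 2 K) := by
    rw [show 4 * c = 2 * c * ((2 : ℕ) : integers 2 K) by push_cast; ring]
    exact Ideal.mul_mem_left _ _ h2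
  have : (1 : integers 2 K) ∈ maximalIdeal (integers 2 K) := by
    simpa using sub_mem (show 1 + 4 * c ∈ maximalIdeal (integers 2 K) from h) h4
  exact this isUnit_one

theorem unitsModFourQuotient_surjective : Function.Surjective (unitsModFourQuotient K) := by
  intro y
  obtain ⟨c, hc⟩ := Ideal.Quotient.mk_surjective y.toAdd
  have hu := isUnit_one_add_four_mul c
  refine ⟨⟨hu.unit, (mem_unitFiltration_two_mul_ramIdx_iff _).2 ⟨c, hu.unit_spec⟩⟩, ?_⟩
  rw [unitsModFourQuotient_apply _ hu.unit_spec, hc, ofAdd_toAdd]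

/-- The kernel is `1 + 8𝔬`, which equals `V²`: `(1 + 4a)² = 1 + 8(a + 2a²)`, and Hensel gives the
converse. -/
theorem ker_unitsModFourQuotient :
    (unitsModFourQuotient K).ker =
      ((unitsModFour K).map (powMonoidHom 2)).subgroupOf (unitsModFour K) := by
  ext x
  obtain ⟨c, hc⟩ := (mem_unitFiltration_two_mul_ramIdx_iff _).1 x.2
  rw [MonoidHom.mem_ker, unitsModFourQuotient_apply x hc, ofAdd_eq_one,
    Ideal.Quotient.eq_zero_iff_mem, Ideal.mem_span_singleton, Subgroup.mem_subgroupOf]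
  constructor
  · rintro ⟨z, rfl⟩
    obtain ⟨a, ha⟩ := exists_eq_one_add_four_mul_of_eq_one_add_eight_mul (z := z) (Units.isUnit _)
      (by rw [hc]; push_cast; ring)
    have hu := isUnit_one_add_four_mul a
    refine ⟨hu.unit, (mem_unitFiltration_two_mul_ramIdx_iff _).2 ⟨a, hu.unit_spec⟩, ?_⟩
    exact Units.ext (by rw [ha]; rfl)
  · rintro ⟨y, hy, hyx⟩
    obtain ⟨a, ha⟩ := (mem_unitFiltration_two_mul_ramIdx_iff _).1 hy
    refine ⟨a + 2 * a ^ 2, mul_left_cancel₀ (OfNat.ofNat_ne_zero 4 : (4 : integers 2 K) ≠ 0) ?_⟩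
    have : ((x : (integers 2 K)ˣ) : integers 2 K) = (y : integers 2 K) ^ 2 := by
      rw [← hyx]
      rfl
    rw [hc, ha] at this
    push_cast
    linear_combination this

variable (K) in
theorem relIndex_map_unitsModFour :
    ((unitsModFour K).map (powMonoidHom 2)).relIndex (unitsModFour K) =
      2 ^ Module.finrank ℚ_[2] K := by
  rw [Subgroup.relIndex, ← ker_unitsModFourQuotient, Subgroup.index_ker,
    MonoidHom.range_eq_top.2 unitsModFourQuotient_surjective, Subgroup.card_top,
    ← natCard_quotient_prime 2 K]
  rfl

theorem index_unitFiltration_ne_zero (p : ℕ) [Fact p.Prime] (K : Type*) [Field K] [Algebra ℚ_[p] K]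
    [FiniteDimensional ℚ_[p] K] (n : ℕ) : (unitFiltration p K n).index ≠ 0 := by
  have : Finite (integers p K ⧸ maximalIdeal (integers p K) ^ n) :=
    finite_quotient_iff.2 ⟨n, le_rfl⟩
  rw [unitFiltration, Subgroup.index_ker]
  exact Nat.card_pos.ne'

theorem card_ker_sq : Nat.card (powMonoidHom 2 : (integers 2 K)ˣ →* (integers 2 K)ˣ).ker = 2 := by
  have hker : ((powMonoidHom 2 : (integers 2 K)ˣ →* (integers 2 K)ˣ).ker : Set (integers 2 K)ˣ) =
      {1, -1} := by
    ext x
    change x ^ 2 = 1 ↔ x = 1 ∨ x = -1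
    simp only [Units.ext_iff, Units.val_pow_eq_pow_val, Units.val_one, Units.val_neg,
      sq_eq_one_iff]
  have hne : (1 : (integers 2 K)ˣ) ≠ -1 := by
    simp only [Ne, Units.ext_iff, Units.val_one, Units.val_neg, self_eq_neg, one_ne_zero,
      not_false_eq_true]
  rw [← SetLike.coe_sort_coe, hker, Nat.card_coe_set_eq, Set.ncard_pair hne]

/-- `-1 = 1 + 4c` would give `2 · (-c) = 1`, but `2` is not a unit. -/
theorem disjoint_unitsModFour_ker_sq :
    Disjoint (unitsModFour K) (powMonoidHom 2 : (integers 2 K)ˣ →* (integers 2 K)ˣ).ker := by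
  rw [Subgroup.disjoint_def]
  intro x hx hx2
  have hx2 : x ^ 2 = 1 := hx2
  obtain ⟨c, hc⟩ := (mem_unitFiltration_two_mul_ramIdx_iff _).1 hx
  rw [Units.ext_iff, Units.val_pow_eq_pow_val, Units.val_one, sq_eq_one_iff] at hx2
  refine Units.ext (hx2.resolve_right fun h => ?_)
  refine natCast_prime_not_isUnit 2 K (IsUnit.of_mul_eq_one (-c) ?_)
  refine mul_left_cancel₀ (two_ne_zero (α := integers 2 K)) ?_
  rw [h] at hc
  push_cast
  linear_combination hc

variable (K) in
/-- For `p = 2` the group `𝔬ˣ/𝔬ˣ²` has `2 ^ (d + 1)` elements. -/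
theorem index_range_sq :
    (powMonoidHom 2 : (integers 2 K)ˣ →* (integers 2 K)ˣ).range.index =
      2 ^ (Module.finrank ℚ_[2] K + 1) := by
  set sq : (integers 2 K)ˣ →* (integers 2 K)ˣ := powMonoidHom 2
  set V := unitsModFour K
  have hV : V.index ≠ 0 := index_unitFiltration_ne_zero 2 K _
  have hle : V.map sq ≤ V := by
    rintro _ ⟨x, hx, rfl⟩
    exact pow_mem hx 2
  -- The index of `V²` in `𝔬ˣ` computed in two ways: through the image of squaring, and through `V`.
  have h1 : (V ⊔ sq.ker).index * sq.range.index = 2 ^ Module.finrank ℚ_[2] K * V.index := by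
    rw [← Subgroup.index_map, ← Subgroup.relIndex_mul_index hle, relIndex_map_unitsModFour]
  have h2 : 2 * (V ⊔ sq.ker).index = V.index := by
    rw [← Subgroup.relIndex_mul_index (le_sup_left : V ≤ V ⊔ sq.ker), sup_comm,
      Subgroup.relIndex_sup_right, Subgroup.relIndex,
      Subgroup.subgroupOf_eq_bot.2 disjoint_unitsModFour_ker_sq, Subgroup.index_bot, card_ker_sq]
  -- An infinite index would be recorded as `0`; finiteness is what permits cancellation.
  have h0 : 0 < (V ⊔ sq.ker).index := Nat.pos_of_ne_zero fun h => hV (by rw [← h2, h])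
  refine Nat.eq_of_mul_eq_mul_left h0 ?_
  rw [h1, ← h2]
  ring

variable (K) in
theorem natCard_barU_zero : Nat.card (barU 2 K 0) = 2 ^ (Module.finrank ℚ_[2] K + 1) := by
  rw [barU_eq_map, unitFiltration_zero, ← MonoidHom.range_eq_map, ← Subgroup.index_ker,
    ker_unitClass, index_range_sq]

end Count

/-! ### Classes of discriminants, and the conclusion. -/

section Discriminant

variable {p : ℕ} [Fact p.Prime] {K : Type*} [Field K] [Algebra ℚ_[p] K]
  [FiniteDimensional ℚ_[p] K] {L : Type*} [Field L] [Algebra K L] [FiniteDimensional K L]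

theorem discrOfBasis_eq_unitClass {ι : Type*} [Fintype ι] [DecidableEq ι]
    (b : Module.Basis ι (integers p K) (extIntegers p K L))
    (h : IsUnit (Algebra.discr (integers p K) b)) :
    discrOfBasis p K L b = unitClass p K h.unit :=
  congrArg QuotientGroup.mk (Units.ext (discr_basis_eq p K L b))

theorem discrOfBasis_mem_barU {ι : Type*} [Fintype ι] [DecidableEq ι]
    (b : Module.Basis ι (integers p K) (extIntegers p K L))
    (h : IsUnit (Algebra.discr (integers p K) b)) :
    discrOfBasis p K L b ∈ barU p K (2 * ramIdx p K) := by
  obtain ⟨s, t, hst⟩ := exists_discr_eq_sq_sub_four_mul p K L b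
  rw [discrOfBasis_eq_unitClass b h]
  exact unitClass_mem_barU_of_eq_sq_sub (h.unit_spec.trans hst)

/-- Representatives of a class differ by squares of units, so being a unit depends only on the
class. This makes Stickelberger applicable without assuming `L | K` unramified. -/
theorem isUnit_discr_of_discrOfBasis_mem {ι : Type*} [Fintype ι] [DecidableEq ι]
    (b : Module.Basis ι (integers p K) (extIntegers p K L))
    (h : discrOfBasis p K L b ∈ barU p K 0) : IsUnit (Algebra.discr (integers p K) b) := by
  rw [barU_eq_map] at h
  obtain ⟨x, -, hx⟩ := h
  obtain ⟨_, ⟨w, rfl⟩, hw⟩ := QuotientGroup.eq.1 hx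
  have hK := congrArg Units.val (eq_inv_mul_iff_mul_eq.1 hw)
  have : algebraMap (integers p K) K ((x : integers p K) * (w : integers p K) ^ 2) =
      algebraMap (integers p K) K (Algebra.discr (integers p K) b) := by
    rw [← discr_basis_eq, map_mul, map_pow]
    exact hK
  rw [← FaithfulSMul.algebraMap_injective (integers p K) K this]
  exact x.isUnit.mul (w.isUnit.pow 2)

/-- The discriminant of an extension belongs to `Ū_{2e}` as soon as it is a unit. -/
theorem discr_mem_barU_of_mem_barU_zero (h : discr p K L ∈ barU p K 0) :
    discr p K L ∈ barU p K (2 * ramIdx p K) :=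
  discrOfBasis_mem_barU _ (isUnit_discr_of_discrOfBasis_mem _ h)

theorem discr_mem_barU_of_isUnramified (h : IsUnramified p K L) :
    discr p K L ∈ barU p K (2 * ramIdx p K) :=
  discrOfBasis_mem_barU _ (isUnit_discr_of_isUnramified p h _)

theorem discr_eq_one_iff_of_isUnramified (h : IsUnramified p K L) :
    discr p K L = 1 ↔ Odd (Module.finrank K L) := by
  classical
  set b := Module.Free.chooseBasis (integers p K) (extIntegers p K L)
  have hu := isUnit_discr_of_isUnramified p h b
  rw [← isSquare_discr_iff_odd_of_isUnramified p h b, ← discrOfBasis_eq_discr p K L b,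
    discrOfBasis_eq_unitClass b hu, unitClass_eq_one_iff, IsUnit.unit_spec, ← isSquare_coe_iff,
    discr_basis_eq]
  rfl

end Discriminant

end LocalDisc

theorem proposition15 (p : ℕ) [Fact p.Prime] (K : Type u) [Field K] [Algebra ℚ_[p] K]
    [FiniteDimensional ℚ_[p] K] :
    ∃ u : LocalDisc.UnitClasses p K,
      u ≠ 1 ∧
      (LocalDisc.barU p K (2 * LocalDisc.ramIdx p K) : Set (LocalDisc.UnitClasses p K)) = {1, u} ∧
      (∀ (L : Type v) [Field L] [Algebra K L] [FiniteDimensional K L],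
        LocalDisc.IsUnramified p K L →
          LocalDisc.discr p K L ∈ LocalDisc.barU p K (2 * LocalDisc.ramIdx p K) ∧
          (Odd (Module.finrank K L) → LocalDisc.discr p K L = 1) ∧
          (Even (Module.finrank K L) → LocalDisc.discr p K L = u)) ∧
      (p = 2 →
        ((LocalDisc.barU p K 0 : Set (LocalDisc.UnitClasses p K)) \ {1, u}).ncard =
          2 ^ (Module.finrank ℚ_[p] K + 1) - 2 ∧
        ∀ c ∈ (LocalDisc.barU p K 0 : Set (LocalDisc.UnitClasses p K)) \ {1, u},
          ∀ (L : Type v) [Field L] [Algebra K L] [FiniteDimensional K L],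
            LocalDisc.discr p K L ≠ c) := by
  obtain ⟨u, hu1, hu⟩ := LocalDisc.exists_barU_two_mul_ramIdx_eq p K
  refine ⟨u, hu1, hu, fun L _ _ _ hL => ?_, fun hp => ⟨?_, fun c hc L _ _ _ h => ?_⟩⟩
  · have hmem := LocalDisc.discr_mem_barU_of_isUnramified hL
    refine ⟨hmem, (LocalDisc.discr_eq_one_iff_of_isUnramified hL).2, fun heven => ?_⟩
    rw [← SetLike.mem_coe, hu] at hmem
    refine hmem.resolve_left fun h1 => ?_
    exact Nat.not_odd_iff_even.2 heven ((LocalDisc.discr_eq_one_iff_of_isUnramified hL).1 h1)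
  · subst hp
    -- As `{1, u}` is `Ū_{2e}`, it lies in `Ū_0`, so exactly two elements are removed.
    have hsub : ({1, u} : Set (LocalDisc.UnitClasses 2 K)) ⊆ LocalDisc.barU 2 K 0 := by
      rw [← hu, LocalDisc.barU_eq_map, LocalDisc.barU_eq_map, LocalDisc.unitFiltration_zero]
      exact Subgroup.map_mono le_top
    rw [Set.ncard_sdiff hsub (Set.toFinite _), Set.ncard_pair hu1.symm, ← Nat.card_coe_set_eq]
    exact congrArg (· - 2) (LocalDisc.natCard_barU_zero K)
  · subst h
    refine hc.2 ?_
    rw [← hu]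
    exact LocalDisc.discr_mem_barU_of_mem_barU_zero hc.1
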